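/- Let $k$ be a field and let $K=k(C)$ be the function field of a curve $C$ over $k$ with full constant field $k$; that is, $K/k$ is a finitely generated field extension of transcendence degree one and $k$ is algebraically closed in $K$. The places $p$ of $K$ are the normalized (surjective) discrete valuations $\nu_p : K \to \mathbb{Z}\cup\{\infty\}$ that are trivial on $k$. For each place $p$ let $|a|_p = c_p^{-\nu_p(a)}$, where $c_p>1$ is any choice of real numbers (for instance one for which the product formula holds). Let $K_p$ be the completion of $K$ with respect to $|\cdot|_p$, let $\overline{K}_p$ be an algebraic closure of $K_p$, and denote also by $|\cdot|_p$ the unique extension of the absolute value to $\overline{K}_p$. Let $M$ be a free abelian group of finite rank, let $T=\operatorname{Spec} K[M]$ be the split torus over $K$ with character lattice $M$, and let $N_{\mathbb{R}}=\operatorname{Hom}(M,\mathbb{R})$ with its usual topology. A point $x\in T(\overline{K}_p)$ determines the point $-\log|x|_p\in N_{\mathbb{R}}$ given by $u\mapsto -\log|\chi^u(x)|_p$. For a closed subscheme $X\subseteq T$, the amoeba of $X$ at $p$ and the adelic amoeba of $X$ are $$\mathcal{A}_p(X)=\overline{\{-\log|x|_p : x\in X(\overline{K}_p)\}}\subseteq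 N_{\mathbb{R}},\qquad \mathcal{A}_{\mathbb{A}}(X)=\bigcup_p \mathcal{A}_p(X),$$ where the union is over all places $p$ of $K$. An open half line in $N_{\mathbb{R}}$ is a set $\mathbb{R}_{>0}\cdot v$ with $0\neq v\in N_{\mathbb{R}}$. **Proposition 3.2.** Let $X=V(f)\subseteq T$ be a hypersurface, where $f\in K[M]$ is a Laurent polynomial with at least two nonzero terms. Then $\mathcal{A}_{\mathbb{A}}(X)$ is disjoint from some open half line in $N_{\mathbb{R}}$ if and only if $X$ is defined over $k$, that is, if and only if $X$ is the base change to $K$ of a closed subscheme of $\operatorname{Spec} k[M]$ (equivalently, in terms of ideals, $(f)=J\cdot K[M]$ for some ideal $J$ of $k[M]$). -/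

import Mathlib

open scoped NNReal WithZero

noncomputable section

namespace AdelicAmoeba

/-- `K` is the function field of a curve over `k`, with full constant field `k`: a finitely
generated field extension of transcendence degree one in which `k` is algebraically closed. -/
structure IsCurveFunctionField (k K : Type*) [Field k] [Field K] [Algebra k K] : Prop where
  fg : (⊤ : IntermediateField k K).FG
  trdeg_eq_one : Algebra.trdeg k K = 1
  mem_range_of_isAlgebraic : ∀ a : K, IsAlgebraic k a → a ∈ (algebraMap k K).range

/-- A place of `K` over `k` (a closed point of the regular projective model of `K`), given by its
discrete valuation `ν_p : K → ℤ ∪ {∞}`, normalized to be surjective and trivial on `k`.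
It is written multiplicatively: `valuation a = exp (-ν_p(a))`. -/
structure Place (k K : Type*) [Field k] [Field K] [Algebra k K] where
  valuation : Valuation K ℤᵐ⁰
  trivial_on : ∀ a : k, a ≠ 0 → valuation (algebraMap k K a) = 1
  surjective : Function.Surjective valuation

variable {k K : Type*} [Field k] [Field K] [Algebra k K]

namespace Place

/-- The absolute value `|a|_p = c ^ (-ν_p(a))`, for a real number `c > 1`. -/
def absVal (p : Place k K) {c : ℝ≥0} (hc : 1 < c) : AbsoluteValue K ℝ where
  toFun a := WithZeroMulInt.toNNReal (ne_zero_of_lt hc) (p.valuation a)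
  map_mul' a b := by simp
  nonneg' a := NNReal.coe_nonneg _
  eq_zero' a := by simp
  add_le' a b := by
    have hm := (WithZeroMulInt.toNNReal_strictMono hc).monotone
    have h := hm (p.valuation.map_add a b)
    rw [hm.map_max] at h
    exact_mod_cast h.trans (max_le_add_of_nonneg bot_le bot_le)

theorem absVal_natCast_le_one (p : Place k K) {c : ℝ≥0} (hc : 1 < c) (n : ℕ) :
    p.absVal hc (n : K) ≤ 1 := by
  have h : p.valuation (n : K) ≤ 1 := by
    induction n with
    | zero => simp
    | succ m ih =>
      push_cast
      exact (p.valuation.map_add _ _).trans (max_le ih (by simp))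
  have := (WithZeroMulInt.toNNReal_strictMono hc).monotone h
  rw [map_one] at this
  exact_mod_cast this

theorem exists_one_lt_absVal (p : Place k K) {c : ℝ≥0} (hc : 1 < c) :
    ∃ a : K, 1 < p.absVal hc a := by
  obtain ⟨a, ha⟩ := p.surjective (WithZero.exp 1)
  refine ⟨a, ?_⟩
  have h : (1 : ℤᵐ⁰) < p.valuation a := by
    rw [ha, ← WithZero.exp_zero, WithZero.exp_lt_exp]; exact one_pos
  have := WithZeroMulInt.toNNReal_strictMono hc h
  rw [map_one] at this
  exact_mod_cast this

/-- The completion `K_p` of `K` with respect to `| |_p`. -/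
abbrev Completion (p : Place k K) {c : ℝ≥0} (hc : 1 < c) : Type _ :=
  (p.absVal hc).Completion

/-- The embedding of `K` in `K_p`. -/
def toCompletion (p : Place k K) {c : ℝ≥0} (hc : 1 < c) : K →+* p.Completion hc :=
  (UniformSpace.Completion.coeRingHom : WithAbs (p.absVal hc) →+* p.Completion hc).comp
    (WithAbs.equiv (p.absVal hc)).symm.toRingHom

theorem norm_toCompletion (p : Place k K) {c : ℝ≥0} (hc : 1 < c) (a : K) :
    ‖p.toCompletion hc a‖ = p.absVal hc a :=
  UniformSpace.Completion.norm_coe (E := WithAbs (p.absVal hc)) _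

instance (p : Place k K) {c : ℝ≥0} (hc : 1 < c) : NontriviallyNormedField (p.Completion hc) where
  non_trivial := by
    obtain ⟨a, ha⟩ := p.exists_one_lt_absVal hc
    exact ⟨p.toCompletion hc a, by rwa [norm_toCompletion]⟩

instance (p : Place k K) {c : ℝ≥0} (hc : 1 < c) : IsUltrametricDist (p.Completion hc) :=
  IsUltrametricDist.isUltrametricDist_of_forall_norm_natCast_le_one fun n => by
    rw [← map_natCast (p.toCompletion hc) n, norm_toCompletion]
    exact p.absVal_natCast_le_one hc n

/-- The algebraic closure of `K_p`. -/
abbrev AlgClosure (p : Place k K) {c : ℝ≥0} (hc : 1 < c) : Type _ :=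
  AlgebraicClosure (p.Completion hc)

/-- The embedding of `K` in the algebraic closure of `K_p`. -/
def toAlgClosure (p : Place k K) {c : ℝ≥0} (hc : 1 < c) : K →+* p.AlgClosure hc :=
  (algebraMap (p.Completion hc) (p.AlgClosure hc)).comp (p.toCompletion hc)

/-- The unique extension of `| |_p` to the algebraic closure of `K_p`. -/
def algAbs (p : Place k K) {c : ℝ≥0} (hc : 1 < c) :
    MulAlgebraNorm (p.Completion hc) (p.AlgClosure hc) :=
  spectralMulAlgNorm (p.Completion hc) (p.AlgClosure hc)

/-- The extended absolute value is `|x|_p = |N(x)|_p ^ (1 / [K_p(x) : K_p])`, for the norm `N` from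
`K_p(x)` to `K_p`. -/
theorem algAbs_eq_norm_rpow (p : Place k K) {c : ℝ≥0} (hc : 1 < c) (x : p.AlgClosure hc) :
    p.algAbs hc x =
      ‖Algebra.norm (p.Completion hc)
        (IntermediateField.AdjoinSimple.gen (p.Completion hc) x)‖ ^
      (1 / (Module.finrank (p.Completion hc)
        (IntermediateField.adjoin (p.Completion hc) {x}) : ℝ)) := by
  have hx : IsIntegral (p.Completion hc) x := Algebra.IsIntegral.isIntegral x
  rw [algAbs, spectralMulAlgNorm_def, spectralNorm.spectralNorm_eq_norm_coeff_zero_rpow,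
    IntermediateField.adjoin.finrank hx]
  have h := Algebra.PowerBasis.norm_gen_eq_coeff_zero_minpoly
    (IntermediateField.adjoin.powerBasis hx)
  rw [IntermediateField.adjoin.powerBasis_gen, IntermediateField.minpoly_gen] at h
  rw [h, norm_mul, norm_pow, norm_neg, norm_one, one_pow, one_mul]

end Place

/-- The real vector space `N_ℝ = Hom(M, ℝ)`, for the character lattice `M` of a torus, carries the
topology of pointwise convergence on `M`. For `M` of finite rank this is the usual topology of
a finite-dimensional real vector space. -/
instance (M : Type*) [AddCommGroup M] : TopologicalSpace (M →+ ℝ) :=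
  TopologicalSpace.induced (fun v : M →+ ℝ => (v : M → ℝ)) inferInstance

variable {M : Type*} [AddCommGroup M]

/-- For a closed subscheme `X` of the torus `T = Spec K[M]`, given by its ideal `I`, the set `X(L)`
of its points over an extension `φ : K → L`. A point `x` of `T(L)` is given by its evaluation map
`u ↦ χ^u(x)` from `M` to `Lˣ`. -/
def points (I : Ideal (AddMonoidAlgebra K M)) {L : Type*} [Field L] (φ : K →+* L) :
    Set (Multiplicative M →* Lˣ) :=
  {x | ∀ f ∈ I, f.coeff.sum (fun u a => φ a * (x (Multiplicative.ofAdd u) : L)) = 0}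

/-- The point `-log |x|_p` of `N_ℝ`, for `x` in `T` over the algebraic closure of `K_p`. -/
def negLogAbs (p : Place k K) {c : ℝ≥0} (hc : 1 < c) (x : Multiplicative M →* (p.AlgClosure hc)ˣ) :
    M →+ ℝ where
  toFun u := -Real.log (p.algAbs hc (x (Multiplicative.ofAdd u) : p.AlgClosure hc))
  map_zero' := by simp
  map_add' u v := by
    rw [ofAdd_add, map_mul, Units.val_mul, map_mul, Real.log_mul, neg_add]
    · exact fun h => Units.ne_zero _ (eq_zero_of_map_eq_zero (p.algAbs hc) h)
    · exact fun h => Units.ne_zero _ (eq_zero_of_map_eq_zero (p.algAbs hc) h)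

/-- The amoeba of `X` at the place `p`. -/
def amoeba (I : Ideal (AddMonoidAlgebra K M)) (p : Place k K) {c : ℝ≥0} (hc : 1 < c) :
    Set (M →+ ℝ) :=
  closure (negLogAbs p hc '' points I (p.toAlgClosure hc))

/-- The adelic amoeba of `X`: the union of the amoebas of `X` at all places of `K` over `k`, where
the absolute value at `p` is normalized as `|a|_p = (c p) ^ (-ν_p(a))`. -/
def adelicAmoeba (I : Ideal (AddMonoidAlgebra K M)) (c : Place k K → ℝ≥0) (hc : ∀ p, 1 < c p) :
    Set (M →+ ℝ) :=
  ⋃ p : Place k K, amoeba I p (hc p)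

/-- The open half line `ℝ_{>0} · v`. -/
def openHalfLine (v : M →+ ℝ) : Set (M →+ ℝ) :=
  {w | ∃ t : ℝ, 0 < t ∧ w = t • v}

/-- `X` is a hypersurface: it is cut out by one Laurent polynomial with at least two terms. -/
def IsHypersurface (I : Ideal (AddMonoidAlgebra K M)) : Prop :=
  ∃ f : AddMonoidAlgebra K M, 2 ≤ f.coeff.support.card ∧ I = Ideal.span {f}

variable (k) in
/-- `X` is defined over `k`: it is the base change to `K` of a closed subscheme of `Spec k[M]`. -/
def IsDefinedOver (I : Ideal (AddMonoidAlgebra K M)) : Prop :=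
  ∃ J : Ideal (AddMonoidAlgebra k M),
    I = J.map (AddMonoidAlgebra.mapRingHom M (algebraMap k K))

end AdelicAmoeba

end

/-!
A place of `K` enters through Kapranov's theorem: the amoeba at `p` of the zero locus of
`f = ∑ a_u χ^u` is the set of `w` at which the minimum of `-log |a_u|_p + ⟨u, w⟩` is attained at
least twice. One inclusion is the ultrametric inequality, used in the weak form
`exists_ne_of_mem_amoeba`; the other one (`mem_amoeba_of_min_attained_twice`) reduces to Newton
polygons by restricting `f` to translates of a one-parameter subgroup that separates its exponents,
and uses the density of the value group of the algebraic closure of `K_p` to reach all real `w`.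

If `X` is defined over `k`, its ideal contains a nonzero `g` with coefficients in `k`. All of these
have absolute value `1` everywhere, so a `v` that takes distinct values on the exponents of `g` spans
a half line that misses every amoeba.

Conversely, if the half line of `v` misses every amoeba, then for each `p` the minimum is
attained only once at each `t v`, and by connectedness always at the same exponent `u_p`. Letting
`t → 0` and `t → ∞` gives `|a_u|_p ≤ |a_{u_p}|_p` and `⟨u_p, v⟩ ≤ ⟨u, v⟩` for all `u`. At a place
where all the coefficients of `f` are units (`IsCurveFunctionField.exists_valuation_eq_one`) the
exponent `u_p` is the unique minimum of `v` on the exponents, so every other place must have the same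
one. Hence the quotients `a_u / a_{u_p}` have no poles, and since a transcendental element has one
(`IsCurveFunctionField.exists_one_lt_valuation`), they lie in `k`.

Places are built from a valuation ring that dominates `k[1 / z]` at the origin: because `K` is
finite over `k(z)`, a fixed power of each value lies in the cyclic group generated by the value of
`z`, so the valuation is discrete. This needs no separability.
-/

namespace AdelicAmoeba

open Polynomial
open scoped NNReal WithZero

/-! ### Places of a function field -/

/-- A nontrivial valuation whose values have a common positive power lying in an infinite cyclic
group can be normalized to a place. -/
theorem exists_place_of_pow_eq_zpow {k K : Type*} [Field k] [Field K] [Algebra k K]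
    {Γ : Type*} [LinearOrderedCommGroupWithZero Γ] (v : Valuation K Γ) (hv : v.IsTrivialOn k)
    {γ : Γ} (hγ : 1 < γ) {N : ℕ} (hN : N ≠ 0)
    (h : ∀ y, y ≠ 0 → ∃ m : ℤ, v y ^ N = γ ^ m) {z : K} (hz : 1 < v z) :
    ∃ p : Place k K, ∀ y, 1 < p.valuation y ↔ 1 < v y := by
  classical
  have hz0 : z ≠ 0 := by rintro rfl; simp at hz
  have hγ0 : γ ≠ 0 := (zero_lt_one.trans hγ).ne'
  let S : AddSubgroup ℤ :=
    { carrier := {m | ∃ y : K, y ≠ 0 ∧ v y ^ N = γ ^ m}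
      zero_mem' := ⟨1, one_ne_zero, by simp⟩
      add_mem' := by
        rintro m n ⟨y, hy, hm⟩ ⟨w, hw, hn⟩
        exact ⟨y * w, mul_ne_zero hy hw, by rw [map_mul, mul_pow, hm, hn, zpow_add₀ hγ0]⟩
      neg_mem' := by
        rintro m ⟨y, hy, hm⟩
        exact ⟨y⁻¹, inv_ne_zero hy, by rw [map_inv₀, inv_pow, hm, zpow_neg]⟩ }
  obtain ⟨g, hg⟩ := Int.subgroup_cyclic S
  rw [← AddSubgroup.zmultiples_eq_closure, ← Int.zmultiples_natAbs] at hg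
  set d : ℕ := g.natAbs
  have hd : d ≠ 0 := by
    intro hd
    obtain ⟨m, hm⟩ := h z hz0
    have hmS : m ∈ S := ⟨z, hz0, hm⟩
    rw [hg, hd] at hmS
    have hm0 : m = 0 := by simpa using hmS
    rw [hm0, zpow_zero] at hm
    exact (one_lt_pow₀ hz hN).ne' hm
  set δ : Γ := γ ^ d with hδ
  have hδ1 : 1 < δ := one_lt_pow₀ hγ hd
  have hj : ∀ y, ∃ j : ℤ, y ≠ 0 → v y ^ N = δ ^ j := by
    intro y
    by_cases hy : y = 0
    · exact ⟨0, fun h => absurd hy h⟩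
    obtain ⟨m, hm⟩ := h y hy
    have hmS : m ∈ S := ⟨y, hy, hm⟩
    rw [hg, AddSubgroup.mem_zmultiples_iff] at hmS
    obtain ⟨j, rfl⟩ := hmS
    refine ⟨j, fun _ => ?_⟩
    rw [hm, hδ, smul_eq_mul, mul_comm, zpow_mul, zpow_natCast]
  choose j hj using hj
  have hle : ∀ y w, y ≠ 0 → w ≠ 0 → (j y ≤ j w ↔ v y ≤ v w) := by
    intro y w hy hw
    rw [← zpow_le_zpow_iff_right₀ hδ1, ← hj y hy, ← hj w hw]
    exact pow_le_pow_iff_left₀ zero_le zero_le hN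
  have hval : ∀ y m, y ≠ 0 → v y ^ N = δ ^ m → j y = m := by
    intro y m hy hm
    rw [hj y hy] at hm
    exact zpow_right_injective₀ (zero_lt_one.trans hδ1) hδ1.ne' hm
  let μ : K → ℤᵐ⁰ := fun y => if y = 0 then 0 else WithZero.exp (j y)
  have hμ : ∀ y w, μ y ≤ μ w ↔ v y ≤ v w := by
    intro y w
    by_cases hy : y = 0
    · simp [μ, hy]
    by_cases hw : w = 0
    · simp [μ, hy, hw]
    · simp [μ, hy, hw, hle]
  have hj1 : j 1 = 0 := hval _ _ one_ne_zero (by simp)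
  let V : Valuation K ℤᵐ⁰ :=
    { toFun := μ
      map_zero' := by simp [μ]
      map_one' := by simp [μ, hj1]
      map_mul' := by
        intro y w
        by_cases hy : y = 0
        · simp [μ, hy]
        by_cases hw : w = 0
        · simp [μ, hw]
        have : j (y * w) = j y + j w := hval _ _ (mul_ne_zero hy hw) (by
          rw [map_mul, mul_pow, hj y hy, hj w hw, zpow_add₀ (zero_lt_one.trans hδ1).ne'])
        simp [μ, hy, hw, this, WithZero.exp_add]
      map_add_le_max' := by
        intro y w
        rw [le_max_iff, hμ, hμ, ← le_max_iff]
        exact v.map_add y w }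
  have hV : ∀ y w, V y ≤ V w ↔ v y ≤ v w := hμ
  refine ⟨⟨V, fun a ha => ?_, fun m => ?_⟩, fun y => ?_⟩
  · have h1 : v (algebraMap k K a) = v 1 := by rw [hv.eq_one a ha, map_one]
    rw [← map_one V]
    exact le_antisymm ((hV _ _).2 h1.le) ((hV _ _).2 h1.ge)
  · induction m using WithZero.expRecOn with
    | zero => exact ⟨0, map_zero V⟩
    | exp m =>
      have hm : (d : ℤ) * m ∈ S := by
        rw [hg, AddSubgroup.mem_zmultiples_iff]
        exact ⟨m, by simp [mul_comm]⟩
      obtain ⟨y, hy, hym⟩ := hm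
      refine ⟨y, ?_⟩
      rw [zpow_mul, zpow_natCast] at hym
      change μ y = _
      simp [μ, hy, hval y m hy hym]
  · have h1 : V y ≤ 1 ↔ v y ≤ 1 := by simpa using hV y 1
    exact not_iff_not.1 (by simpa using h1)

/-- A finite sum that vanishes has two nonzero terms of the same value, since its largest term cannot
be unique. -/
theorem exists_ne_valuation_eq_of_sum_eq_zero {R Γ ι : Type*} [Ring R]
    [LinearOrderedCommGroupWithZero Γ] (v : Valuation R Γ) (S : Finset ι) (t : ι → R)
    (h0 : ∃ i ∈ S, v (t i) ≠ 0) (hsum : ∑ i ∈ S, t i = 0) :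
    ∃ i ∈ S, ∃ i' ∈ S, i ≠ i' ∧ v (t i) = v (t i') ∧ v (t i) ≠ 0 := by
  classical
  obtain ⟨i₀, hi₀S, hi₀⟩ := h0
  obtain ⟨i, hiS, hi⟩ := S.exists_max_image (fun i => v (t i)) ⟨i₀, hi₀S⟩
  have hti : v (t i) ≠ 0 := ((zero_lt_iff.2 hi₀).trans_le (hi i₀ hi₀S)).ne'
  by_contra! hne
  have h := Valuation.map_sum_eq_of_lt v hiS fun l hl => by
    rw [Finset.mem_sdiff, Finset.mem_singleton] at hl
    refine lt_of_le_of_ne (hi l hl.1) fun h => hti ?_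
    exact hne i hiS l hl.1 (Ne.symm hl.2) h.symm
  rw [hsum, map_zero] at h
  exact hti h.symm

/-- In a finite extension of degree `d` of a field whose nonzero elements have values in an
infinite cyclic group, the `d!`-th power of each value lies in that group: a linear relation between
`1, y, …, y ^ d` has two nonzero terms of the same value. -/
theorem exists_pow_factorial_eq_zpow {F K Γ : Type*} [Field F] [Field K] [Algebra F K]
    [FiniteDimensional F K] [LinearOrderedCommGroupWithZero Γ] (v : Valuation K Γ) {γ : Γ}
    (h : ∀ c : F, c ≠ 0 → ∃ m : ℤ, v (algebraMap F K c) = γ ^ m) {y : K} (hy : y ≠ 0) (hγ : γ ≠ 0) :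
    ∃ m : ℤ, v y ^ (Module.finrank F K).factorial = γ ^ m := by
  set d := Module.finrank F K
  have hdep : ¬ LinearIndependent F (fun i : Fin (d + 1) => y ^ (i : ℕ)) := by
    intro hli
    have := hli.fintype_card_le_finrank
    simp [d] at this
  obtain ⟨c, hc, i₀, hi₀⟩ := Fintype.not_linearIndependent_iff.1 hdep
  simp_rw [Algebra.smul_def] at hc
  set t : Fin (d + 1) → K := fun i => algebraMap F K (c i) * y ^ (i : ℕ) with ht
  have hvy : v y ≠ 0 := (v.ne_zero_iff).2 hy
  have key : ∀ a b : Fin (d + 1), a < b → v (t a) = v (t b) → v (t a) ≠ 0 →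
      ∃ m : ℤ, v y ^ d.factorial = γ ^ m := by
    intro a b hab hvab h0
    have hca : c a ≠ 0 := by rintro h; simp [ht, h] at h0
    have hcb : c b ≠ 0 := by rintro h; rw [hvab] at h0; simp [ht, h] at h0
    obtain ⟨m, hm⟩ := h _ hca
    obtain ⟨n, hn⟩ := h _ hcb
    simp only [ht, map_mul, map_pow, hm, hn] at hvab
    have hpow : v y ^ ((b : ℕ) - a) = γ ^ (m - n) := by
      have hb : v y ^ (b : ℕ) = v y ^ ((b : ℕ) - a) * v y ^ (a : ℕ) := by
        rw [← pow_add, Nat.sub_add_cancel hab.le]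
      rw [hb, ← mul_assoc] at hvab
      rw [zpow_sub₀ hγ, eq_div_iff (zpow_ne_zero _ hγ), mul_comm]
      exact (mul_right_cancel₀ (pow_ne_zero _ hvy) hvab).symm
    obtain ⟨e, he⟩ := Nat.dvd_factorial (m := (b : ℕ) - a) (n := d) (by omega) (by omega)
    refine ⟨(m - n) * e, ?_⟩
    rw [he, pow_mul, hpow, zpow_mul, zpow_natCast]
  have hti₀ : v (t i₀) ≠ 0 := (v.ne_zero_iff).2 (mul_ne_zero (by simpa using hi₀) (pow_ne_zero _ hy))
  obtain ⟨i, -, i', -, hne, heq, hti⟩ :=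
    exists_ne_valuation_eq_of_sum_eq_zero v Finset.univ t ⟨i₀, by simp, hti₀⟩ hc
  rcases lt_or_gt_of_ne hne with hlt | hlt
  · exact key i i' hlt heq hti
  · exact key i' i hlt heq.symm (heq ▸ hti)

variable {k K : Type*} [Field k] [Field K] [Algebra k K]

/-- A transcendental `z` has a pole at some valuation ring trivial on `k`, namely at one that
dominates `k[z⁻¹]` at the origin. -/
theorem exists_valuationSubring_of_transcendental {z : K} (hz : Transcendental k z) :
    ∃ B : ValuationSubring K, B.valuation.IsTrivialOn k ∧ 1 < B.valuation z := by
  have hz0 : z ≠ 0 := by rintro rfl; exact hz isAlgebraic_zero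
  set x := z⁻¹ with hxz
  have hx : Transcendental k x := fun h => hz (IsAlgebraic.inv_iff.1 h)
  let A : Subring K := (aeval (R := k) x).range.toSubring
  have hxA : x ∈ A := ⟨X, by simp⟩
  have hI : Ideal.span {(⟨x, hxA⟩ : A)} ≠ ⊤ := by
    rw [Ne, Ideal.eq_top_iff_one, Ideal.mem_span_singleton']
    rintro ⟨⟨a, r, hr⟩, ha⟩
    have ha' : a * x = 1 := congrArg Subtype.val ha
    have h1 : aeval x (r * X) = aeval x (1 : k[X]) := by
      rw [map_mul, aeval_X, map_one, ← ha']; congr 1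
    have := transcendental_iff_injective.1 hx h1
    simpa using congrArg (eval 0) this
  obtain ⟨B, hAB, hB⟩ := Ideal.image_subset_nonunits_valuationSubring _ hI
  have hxB : B.valuation x < 1 := by
    rw [← ValuationSubring.mem_nonunits_iff]
    exact hB ⟨⟨x, hxA⟩, Ideal.subset_span rfl, rfl⟩
  have hle : ∀ a : k, B.valuation (algebraMap k K a) ≤ 1 := by
    intro a
    rw [ValuationSubring.valuation_le_one_iff]
    exact hAB ⟨C a, by simp⟩
  refine ⟨B, ⟨fun a ha => le_antisymm (hle a) ?_⟩, ?_⟩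
  · have := hle a⁻¹
    rw [map_inv₀, map_inv₀] at this
    exact (inv_le_one₀ (by simpa [zero_lt_iff] using ha)).1 this
  · rw [hxz, map_inv₀] at hxB
    exact (inv_lt_one₀ (by simpa [zero_lt_iff] using hz0)).1 hxB

theorem IsCurveFunctionField.isAlgebraic_adjoin (hK : IsCurveFunctionField k K) {z : K}
    (hz : Transcendental k z) : Algebra.IsAlgebraic (Algebra.adjoin k {z}) K := by
  have hi : AlgebraicIndependent k (fun _ : Unit => z) :=
    algebraicIndependent_unique_type_iff.2 hz
  have hb := hi.isTranscendenceBasis_of_lift_trdeg_le_of_finite (by simp [hK.trdeg_eq_one])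
  have := hb.isAlgebraic
  rwa [Set.range_const] at this

theorem IsCurveFunctionField.finiteDimensional (hK : IsCurveFunctionField k K) {z : K}
    (hz : Transcendental k z) : FiniteDimensional (IntermediateField.adjoin k {z}) K := by
  have halg := hK.isAlgebraic_adjoin hz
  obtain ⟨s, hs⟩ := hK.fg
  set F := IntermediateField.adjoin k {z}
  have hF : Algebra.IsAlgebraic F K := by
    refine ⟨fun a => ?_⟩
    have hle : Algebra.adjoin k {z} ≤ F.toSubalgebra := IntermediateField.algebra_adjoin_le_adjoin _ _
    obtain ⟨q, hq0, hq⟩ := halg.isAlgebraic a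
    refine ⟨q.map (Subalgebra.inclusion hle).toRingHom, ?_, ?_⟩
    · exact (Polynomial.map_ne_zero_iff (Subalgebra.inclusion_injective hle)).2 hq0
    · rw [aeval_def, eval₂_map]; exact hq
  have htop : IntermediateField.adjoin F (s : Set K) = ⊤ := by
    rw [eq_top_iff]
    intro a _
    have : a ∈ IntermediateField.adjoin k (s : Set K) := by rw [hs]; trivial
    have hle : IntermediateField.adjoin k (s : Set K) ≤
        (IntermediateField.adjoin F (s : Set K)).restrictScalars k :=
      IntermediateField.adjoin_le_iff.2 (IntermediateField.subset_adjoin F _)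
    exact hle this
  have := IntermediateField.finiteDimensional_adjoin (K := F) (S := (s : Set K))
    (fun a _ => (hF.isAlgebraic a).isIntegral)
  rw [htop] at this
  exact Module.Finite.equiv (IntermediateField.topEquiv (F := F) (E := K)).toLinearEquiv

/-- Every transcendental element has a pole. -/
theorem IsCurveFunctionField.exists_one_lt_valuation (hK : IsCurveFunctionField k K) {z : K}
    (hz : Transcendental k z) : ∃ p : Place k K, 1 < p.valuation z := by
  obtain ⟨B, hB, hBz⟩ := exists_valuationSubring_of_transcendental hz
  have := hK.finiteDimensional hz
  have hγ0 : B.valuation z ≠ 0 := (zero_lt_one.trans hBz).ne'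
  have hF : ∀ c : IntermediateField.adjoin k {z}, c ≠ 0 →
      ∃ m : ℤ, B.valuation (algebraMap _ K c) = B.valuation z ^ m := by
    intro c hc
    obtain ⟨r, s, hrs⟩ := (IntermediateField.mem_adjoin_simple_iff k _).1 c.2
    have hc0 : (c : K) ≠ 0 := by simpa using hc
    have hr : r ≠ 0 := by rintro rfl; simp [hrs] at hc0
    have hs : s ≠ 0 := by rintro rfl; simp [hrs] at hc0
    refine ⟨(r.natDegree : ℤ) - s.natDegree, ?_⟩
    change B.valuation (c : K) = _
    rw [hrs, map_div₀, valuation_aeval_eq_valuation_X_pow_natDegree_of_one_lt_valuation_X _ hBz hr,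
      valuation_aeval_eq_valuation_X_pow_natDegree_of_one_lt_valuation_X _ hBz hs,
      zpow_sub₀ hγ0, zpow_natCast, zpow_natCast]
  obtain ⟨p, hp⟩ := exists_place_of_pow_eq_zpow B.valuation hB hBz
    (Nat.factorial_ne_zero (Module.finrank (IntermediateField.adjoin k {z}) K))
    (fun y hy => exists_pow_factorial_eq_zpow B.valuation hF hy hγ0) hBz
  exact ⟨p, (hp z).2 hBz⟩

theorem IsCurveFunctionField.exists_transcendental (hK : IsCurveFunctionField k K) :
    ∃ z : K, Transcendental k z := by
  by_contra! h
  have : Algebra.IsAlgebraic k K := ⟨fun a => not_not.1 (h a)⟩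
  have h0 := trdeg_eq_zero (R := k) (A := K)
  rw [hK.trdeg_eq_one] at h0
  exact one_ne_zero h0

/-- Finitely many nonzero elements of `K` have neither zeros nor poles at some common place. -/
theorem IsCurveFunctionField.exists_valuation_eq_one (hK : IsCurveFunctionField k K)
    (s : Finset K) (hs : ∀ b ∈ s, b ≠ 0) : ∃ p : Place k K, ∀ b ∈ s, p.valuation b = 1 := by
  classical
  obtain ⟨x, hx⟩ := hK.exists_transcendental
  have halg := hK.isAlgebraic_adjoin hx
  obtain ⟨⟨y, hyA⟩, hy0, hy⟩ := Algebra.IsAlgebraic.exists_integral_multiples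
    (R := Algebra.adjoin k {x}) (A := K) (s ∪ s.image (·⁻¹))
  rw [Algebra.adjoin_singleton_eq_range_aeval] at hyA
  obtain ⟨h, rfl : aeval x h = y⟩ := hyA
  have hh : h ≠ 0 := by rintro rfl; exact hy0 (Subtype.ext (map_zero _))
  -- A zero of `x * h(x) + 1` is a place where `x` has no pole and `h(x)` is a unit.
  have hdeg : (X * h + 1 : k[X]).natDegree ≠ 0 := by
    rw [← C_1, natDegree_add_C, natDegree_X_mul hh]; simp
  have hlead : (X * h + 1 : k[X]).leadingCoeff ≠ 0 := by
    rw [Ne, leadingCoeff_eq_zero]; rintro h0; simp [h0] at hdeg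
  have hw : Transcendental k (aeval x (X * h + 1 : k[X]))⁻¹ :=
    fun ha => hx.aeval _ hdeg (by simpa using hlead) (IsAlgebraic.inv_iff.1 ha)
  obtain ⟨p, hp⟩ := hK.exists_one_lt_valuation hw
  have htriv : p.valuation.IsTrivialOn k := ⟨p.trivial_on⟩
  have hw0 : aeval x (X * h + 1 : k[X]) ≠ 0 := by intro h0; simp [h0] at hp
  rw [map_inv₀, one_lt_inv₀ (by simpa [zero_lt_iff] using hw0)] at hp
  have hx1 : p.valuation x ≤ 1 := by
    by_contra! hlt
    have hne : (X * h + 1 : k[X]) ≠ 0 := by rintro h0; simp [h0] at hdeg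
    rw [valuation_aeval_eq_valuation_X_pow_natDegree_of_one_lt_valuation_X _ hlt hne] at hp
    exact (one_lt_pow₀ hlt hdeg).not_gt hp
  have hpol : ∀ r : k[X], p.valuation (aeval x r) ≤ 1 := by
    intro r
    rw [aeval_eq_sum_range]
    refine Valuation.map_sum_le _ fun i _ => ?_
    rw [Algebra.smul_def, map_mul, map_pow]
    refine mul_le_one' ?_ (pow_le_one' hx1 _)
    by_cases h0 : r.coeff i = 0
    · simp [h0]
    · exact (p.trivial_on _ h0).le
  have hh1 : p.valuation (aeval x h) = 1 := by
    have h1 : p.valuation (x * aeval x h) = 1 := by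
      have e : x * aeval x h = aeval x (X * h + 1 : k[X]) + -1 := by simp
      rw [e, Valuation.map_add_eq_of_lt_right _ (by simpa using hp)]
      simp
    refine le_antisymm (hpol h) ?_
    rw [← h1, map_mul]
    exact mul_le_of_le_one_left' hx1
  have hint : ∀ b ∈ s ∪ s.image (·⁻¹), p.valuation b ≤ 1 := by
    intro b hb
    obtain ⟨q, hqm, hq⟩ := hy b hb
    have hA : ∀ a : Algebra.adjoin k {x}, p.valuation (algebraMap _ K a) ≤ 1 := by
      rintro ⟨a, ha⟩
      rw [Algebra.adjoin_singleton_eq_range_aeval] at ha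
      obtain ⟨r, rfl : aeval x r = a⟩ := ha
      exact hpol r
    let φ : Algebra.adjoin k {x} →+* p.valuation.integer :=
      (algebraMap (Algebra.adjoin k {x}) K).codRestrict _ hA
    have hbi : IsIntegral p.valuation.integer (aeval x h * b) := by
      refine ⟨q.map φ, hqm.map _, ?_⟩
      rw [eval₂_map]
      exact hq
    have := (Valuation.integer.integers p.valuation).mem_of_integral hbi
    rw [Valuation.mem_integer_iff, map_mul, hh1, one_mul] at this
    exact this
  refine ⟨p, fun b hb => le_antisymm (hint b (by simp [hb])) ?_⟩
  have := hint b⁻¹ (Finset.mem_union_right _ (Finset.mem_image_of_mem _ hb))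
  rw [map_inv₀] at this
  exact (inv_le_one₀ (by simpa [zero_lt_iff] using hs b hb)).1 this

/-! ### Zeros of polynomials over an algebraically closed valued field -/

section Kapranov

variable {L : Type*} [Field L] (v : Valuation L ℝ≥0)

/-- If no root has absolute value `ρ`, then a single term of a split polynomial dominates on the
circle of radius `ρ`, and its exponent is the number of roots inside the circle. -/
theorem coeff_prod_X_sub_C_lt {ρ : ℝ≥0} (hρ : ρ ≠ 0) (s : Multiset L) (hs : ∀ r ∈ s, v r ≠ ρ) :
    ∀ i, i ≠ (s.filter (v · < ρ)).card →
      v ((s.map (X - C ·)).prod.coeff i) * ρ ^ i <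
        v ((s.map (X - C ·)).prod.coeff (s.filter (v · < ρ)).card) *
          ρ ^ (s.filter (v · < ρ)).card := by
  induction s using Multiset.induction_on with
  | empty => intro i hi; simp [coeff_one, show i ≠ 0 by simpa using hi]
  | cons r s ih =>
    have ih := ih fun a ha => hs a (Multiset.mem_cons_of_mem ha)
    have hr : v r ≠ ρ := hs r (Multiset.mem_cons_self r s)
    set g := (s.map (X - C ·)).prod
    set j := (s.filter (v · < ρ)).card
    have hρ0 : 0 < ρ := pos_iff_ne_zero.2 hρ
    have hle : ∀ i, v (g.coeff i) * ρ ^ i ≤ v (g.coeff j) * ρ ^ j := by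
      intro i
      by_cases hi : i = j
      · rw [hi]
      · exact (ih i hi).le
    have hpos : 0 < v (g.coeff j) * ρ ^ j := lt_of_le_of_lt zero_le (ih (j + 1) (by simp))
    have h0 : v (((X - C r) * g).coeff 0) * ρ ^ 0 = v r * (v (g.coeff 0) * ρ ^ 0) := by
      simp [mul_coeff_zero]
    have hsucc : ∀ i, ((X - C r) * g).coeff (i + 1) = g.coeff i - r * g.coeff (i + 1) := by
      intro i; rw [sub_mul, coeff_sub, coeff_X_mul, coeff_C_mul]
    have h1 : ∀ i, v (g.coeff i) * ρ ^ (i + 1) = ρ * (v (g.coeff i) * ρ ^ i) := by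
      intro i; ring
    have h2 : ∀ i, v (r * g.coeff (i + 1)) * ρ ^ (i + 1) =
        v r * (v (g.coeff (i + 1)) * ρ ^ (i + 1)) := by
      intro i; rw [map_mul]; ring
    have hlt : ∀ i (c : ℝ≥0), ρ * (v (g.coeff i) * ρ ^ i) < c →
        v r * (v (g.coeff (i + 1)) * ρ ^ (i + 1)) < c →
        v (((X - C r) * g).coeff (i + 1)) * ρ ^ (i + 1) < c := by
      intro i c hc1 hc2
      rw [← h1] at hc1
      rw [← h2] at hc2
      rw [hsucc]
      rcases le_total (v (g.coeff i)) (v (r * g.coeff (i + 1))) with h | h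
      · exact lt_of_le_of_lt (mul_le_mul_left ((v.map_sub _ _).trans (max_le h le_rfl)) _) hc2
      · exact lt_of_le_of_lt (mul_le_mul_left ((v.map_sub _ _).trans (max_le le_rfl h)) _) hc1
    simp only [Multiset.map_cons, Multiset.prod_cons]
    rcases lt_or_gt_of_ne hr with hr | hr
    · have hcard : ((r ::ₘ s).filter (v · < ρ)).card = j + 1 := by simp [hr, j]
      have hval : v (((X - C r) * g).coeff (j + 1)) * ρ ^ (j + 1) =
          ρ * (v (g.coeff j) * ρ ^ j) := by
        rw [hsucc, v.map_sub_eq_of_lt_left, h1]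
        refine lt_of_mul_lt_mul_right ?_ (pow_pos hρ0 (j + 1)).le
        rw [h1, h2]
        exact (mul_le_mul_left hr.le _).trans_lt (mul_lt_mul_of_pos_left (ih _ (by simp)) hρ0)
      rw [hcard, hval]
      rintro (_ | i) hi
      · rw [h0]
        exact (mul_le_mul_right (hle 0) _).trans_lt (mul_lt_mul_of_pos_right hr hpos)
      · refine hlt i _ (mul_lt_mul_of_pos_left (ih i fun h => hi (by rw [h])) hρ0) ?_
        exact (mul_le_mul_right (hle _) _).trans_lt (mul_lt_mul_of_pos_right hr hpos)
    · have hr0 : 0 < v r := hρ0.trans hr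
      have hcard : ((r ::ₘ s).filter (v · < ρ)).card = j := by simp [not_lt.2 hr.le, j]
      have hval : v (((X - C r) * g).coeff j) * ρ ^ j = v r * (v (g.coeff j) * ρ ^ j) := by
        obtain _ | j' := j
        · exact h0
        · rw [hsucc, v.map_sub_eq_of_lt_right, h2]
          refine lt_of_mul_lt_mul_right ?_ (pow_pos hρ0 (j' + 1)).le
          rw [h1, h2]
          exact (mul_le_mul_right (hle _) _).trans_lt (mul_lt_mul_of_pos_right hr hpos)
      rw [hcard, hval]
      rintro (_ | i) hi
      · rw [h0]
        exact mul_lt_mul_of_pos_left (ih 0 hi) hr0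
      · refine hlt i _ ?_ (mul_lt_mul_of_pos_left (ih _ hi) hr0)
        exact (mul_le_mul_right (hle _) _).trans_lt (mul_lt_mul_of_pos_right hr hpos)

variable [IsAlgClosed L]

/-- A polynomial whose largest coefficient is attained twice up to a factor `t` has a root of
absolute value in `[t⁻¹, t]`. -/
theorem exists_isRoot_of_coeff_le (g : L[X]) {m n : ℕ} (hmn : m ≠ n) (hm : g.coeff m ≠ 0)
    (hmax : ∀ i, v (g.coeff i) ≤ v (g.coeff m)) {t : ℝ≥0} (ht : 1 ≤ t)
    (hn : v (g.coeff m) ≤ v (g.coeff n) * t) : ∃ r, g.IsRoot r ∧ t⁻¹ ≤ v r ∧ v r ≤ t := by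
  by_contra! hroot
  have hg0 : g ≠ 0 := by rintro rfl; simp at hm
  have ht0 : 0 < t := zero_lt_one.trans_le ht
  have hti : t⁻¹ ≤ t := (inv_le_one_of_one_le₀ ht).trans ht
  have hout : ∀ r ∈ g.roots, v r < t⁻¹ ∨ t < v r := by
    intro r hr
    by_contra! h
    exact (hroot r (isRoot_of_mem_roots hr) h.1).not_ge h.2
  have hfilter : g.roots.filter (v · < t⁻¹) = g.roots.filter (v · < t) := by
    refine Multiset.filter_congr fun r hr => ⟨fun h => h.trans_le hti, fun h => ?_⟩
    exact (hout r hr).resolve_right h.not_gt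
  -- the same term dominates on the circles of radii `t⁻¹` and `t`
  set j := (g.roots.filter (v · < t)).card
  have hdom : ∀ ρ : ℝ≥0, ρ = t ∨ ρ = t⁻¹ → ∀ i, i ≠ j →
      v (g.coeff i) * ρ ^ i < v (g.coeff j) * ρ ^ j := by
    intro ρ hρ i hi
    have hρ0 : ρ ≠ 0 := by rcases hρ with rfl | rfl; exacts [ht0.ne', inv_ne_zero ht0.ne']
    have hj : (g.roots.filter (v · < ρ)).card = j := by
      rcases hρ with rfl | rfl
      · rfl
      · rw [hfilter]
    have h := coeff_prod_X_sub_C_lt v hρ0 g.roots (fun r hr => by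
      rcases hρ with rfl | rfl <;> rcases hout r hr with h | h
      exacts [(h.trans_le hti).ne, h.ne', h.ne, (hti.trans_lt h).ne']) i (by rwa [hj])
    rw [hj] at h
    have hsplit : ∀ l, v (g.coeff l) =
        v g.leadingCoeff * v ((g.roots.map (X - C ·)).prod.coeff l) := by
      intro l
      conv_lhs => rw [(IsAlgClosed.splits g).eq_prod_roots]
      rw [coeff_C_mul, map_mul]
    rw [hsplit, hsplit, mul_assoc, mul_assoc]
    exact mul_lt_mul_of_pos_left h (by simpa [zero_lt_iff] using hg0)
  have hm0 : 0 < v (g.coeff m) := by simpa [zero_lt_iff] using hm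
  have hjm : m = j := by
    by_contra hne
    have h1 := hdom t (Or.inl rfl) m hne
    have h2 := hdom t⁻¹ (Or.inr rfl) m hne
    have h3 := mul_lt_mul'' h1 h2 zero_le zero_le
    have e : ∀ l, v (g.coeff l) * t ^ l * (v (g.coeff l) * t⁻¹ ^ l) = v (g.coeff l) ^ 2 := by
      intro l
      have : t ^ l * t⁻¹ ^ l = 1 := by rw [← mul_pow, mul_inv_cancel₀ ht0.ne', one_pow]
      linear_combination (v (g.coeff l)) ^ 2 * this
    rw [e, e] at h3
    exact (pow_le_pow_left₀ zero_le (hmax j) 2).not_gt h3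
  rw [← hjm] at hdom
  rcases lt_or_gt_of_ne hmn with hlt | hlt
  · refine (hdom t (Or.inl rfl) n hmn.symm).not_ge ?_
    calc v (g.coeff m) * t ^ m ≤ v (g.coeff n) * t * t ^ m := mul_le_mul_left hn _
      _ = v (g.coeff n) * t ^ (m + 1) := by ring
      _ ≤ _ := mul_le_mul_right (pow_le_pow_right₀ ht hlt) _
  · refine (hdom t⁻¹ (Or.inr rfl) n hmn.symm).not_ge ?_
    calc v (g.coeff m) * t⁻¹ ^ m ≤ v (g.coeff n) * t * t⁻¹ ^ m := mul_le_mul_left hn _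
      _ ≤ v (g.coeff n) * t * t⁻¹ ^ (n + 1) := mul_le_mul_right
          (pow_le_pow_of_le_one zero_le (inv_le_one_of_one_le₀ ht) hlt) _
      _ = v (g.coeff n) * t⁻¹ ^ n * (t * t⁻¹) := by ring
      _ = _ := by rw [mul_inv_cancel₀ ht0.ne', mul_one]

/-- The version of `exists_isRoot_of_coeff_le` for Laurent polynomials `∑ c u * X ^ e u`. -/
theorem exists_unit_sum_zpow_eq_zero {M : Type*} (S : Finset M) (c : M → L) (e : M → ℤ)
    (he : Set.InjOn e S) {m n : M} (hmS : m ∈ S) (hnS : n ∈ S) (hmn : m ≠ n) (hm : c m ≠ 0)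
    (hmax : ∀ u ∈ S, v (c u) ≤ v (c m)) {t : ℝ≥0} (ht : 1 ≤ t) (hn : v (c m) ≤ v (c n) * t) :
    ∃ r : Lˣ, ∑ u ∈ S, c u * ((r ^ e u : Lˣ) : L) = 0 ∧ t⁻¹ ≤ v r ∧ v r ≤ t := by
  obtain ⟨u₀, -, hu₀⟩ := S.exists_min_image e ⟨m, hmS⟩
  have hd : ∀ u ∈ S, (((e u - e u₀).toNat : ℕ) : ℤ) = e u - e u₀ := fun u hu =>
    Int.toNat_of_nonneg (sub_nonneg.2 (hu₀ u hu))
  let g : L[X] := ∑ u ∈ S, monomial (e u - e u₀).toNat (c u)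
  have hcoeff : ∀ u ∈ S, g.coeff (e u - e u₀).toNat = c u := by
    intro u hu
    simp only [g, finsetSum_coeff, coeff_monomial]
    rw [Finset.sum_eq_single_of_mem u hu, if_pos rfl]
    intro w hw hwu
    refine if_neg fun h => hwu (he hw hu ?_)
    have := hd u hu
    have := hd w hw
    omega
  have hcoeff0 : ∀ i, (∀ u ∈ S, (e u - e u₀).toNat ≠ i) → g.coeff i = 0 := by
    intro i hi
    simp only [g, finsetSum_coeff, coeff_monomial]
    exact Finset.sum_eq_zero fun u hu => if_neg (hi u hu)
  obtain ⟨r, hr, hr1, hr2⟩ := exists_isRoot_of_coeff_le v g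
    (m := (e m - e u₀).toNat) (n := (e n - e u₀).toNat)
    (fun h => hmn (he hmS hnS (by have := hd m hmS; have := hd n hnS; omega)))
    (by rwa [hcoeff m hmS])
    (fun i => by
      rw [hcoeff m hmS]
      by_cases hi : ∃ u ∈ S, (e u - e u₀).toNat = i
      · obtain ⟨u, hu, rfl⟩ := hi
        rw [hcoeff u hu]
        exact hmax u hu
      · push Not at hi
        simp [hcoeff0 i hi])
    ht (by rwa [hcoeff m hmS, hcoeff n hnS])
  have hr0 : r ≠ 0 := by
    rintro rfl
    rw [map_zero] at hr1
    exact (inv_pos.2 (zero_lt_one.trans_le ht)).not_ge hr1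
  refine ⟨Units.mk0 r hr0, ?_, hr1, hr2⟩
  have hsum : ∑ u ∈ S, c u * r ^ (e u - e u₀).toNat = 0 := by
    have : g.eval r = 0 := hr
    simpa [g, eval_finsetSum] using this
  calc ∑ u ∈ S, c u * ((Units.mk0 r hr0 ^ e u : Lˣ) : L)
      = r ^ e u₀ * ∑ u ∈ S, c u * r ^ (e u - e u₀).toNat := by
        rw [Finset.mul_sum]
        refine Finset.sum_congr rfl fun u hu => ?_
        rw [← zpow_natCast, hd u hu, Units.val_zpow_eq_zpow_val, Units.val_mk0, zpow_sub₀ hr0]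
        field_simp
    _ = 0 := by rw [hsum, mul_zero]

end Kapranov

section Lattice

variable {M : Type*} [AddCommGroup M] [Module.Free ℤ M] [Module.Finite ℤ M]

/-- A cocharacter that separates finitely many characters. -/
theorem exists_addMonoidHom_int_injOn (S : Finset M) : ∃ e : M →+ ℤ, Set.InjOn e S := by
  classical
  let b := Module.finBasis ℤ M
  let P : M → ℤ[X] := fun u => ∑ i : Fin _, monomial (i : ℕ) (b.repr u i)
  have hP : ∀ u, u ≠ 0 → P u ≠ 0 := by
    intro u hu h
    refine hu (b.repr.map_eq_zero_iff.1 (Finsupp.ext fun i => ?_))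
    have := congrArg (fun q => q.coeff (i : ℕ)) h
    simpa [P, finsetSum_coeff, coeff_monomial, Fin.val_inj] using this
  let Q : ℤ[X] := ∏ q ∈ S.offDiag, P (q.1 - q.2)
  have hQ : Q ≠ 0 := Finset.prod_ne_zero_iff.2 fun q hq =>
    hP _ (sub_ne_zero.2 (Finset.mem_offDiag.1 hq).2.2)
  obtain ⟨B, hB⟩ : ∃ B : ℤ, Q.eval B ≠ 0 := by
    by_contra! h
    exact hQ (Polynomial.funext fun B => by simpa using h B)
  refine ⟨AddMonoidHom.mk' (fun u => (P u).eval B) fun u w => ?_, fun u hu w hw huw => ?_⟩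
  · simp [P, eval_finsetSum, Finset.sum_add_distrib]
  · by_contra hne
    rw [eval_prod, Finset.prod_ne_zero_iff] at hB
    refine hB (u, w) (Finset.mem_offDiag.2 ⟨hu, hw, hne⟩) ?_
    have huw : (P u).eval B = (P w).eval B := huw
    have hsub : P (u - w) = P u - P w := by simp [P, Finset.sum_sub_distrib]
    simp [hsub, huw]

variable {L : Type*} [Field L] (v : Valuation L ℝ≥0)

/-- If the value group is dense, then every point of `N_ℝ` is approximated by torus points. -/
theorem exists_monoidHom_neg_log_approx
    (hv : ∀ (a ε : ℝ), 0 < ε → ∃ z : Lˣ, |-Real.log (v z) - a| ≤ ε) (w : M →+ ℝ) :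
    ∃ C : M → ℝ, ∀ ε : ℝ, 0 < ε → ∃ y : Multiplicative M →* Lˣ,
      ∀ u, |-Real.log (v (y (.ofAdd u))) - w u| ≤ C u * ε := by
  let b := Module.finBasis ℤ M
  refine ⟨fun u => ∑ i, |(b.repr u i : ℝ)|, fun ε hε => ?_⟩
  choose z hz using fun i => hv (w (b i)) ε hε
  let y : Multiplicative M →* Lˣ := AddMonoidHom.toMultiplicativeLeft
    (b.constr ℤ (fun i => Additive.ofMul (z i))).toAddMonoidHom
  have hy : ∀ i, y (.ofAdd (b i)) = z i := fun i =>
    congrArg Additive.toMul (b.constr_basis ℤ (fun i => Additive.ofMul (z i)) i)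
  let D : M →+ ℝ := AddMonoidHom.mk' (fun u => -Real.log (v (y (.ofAdd u))) - w u) (by
    intro u u'
    have h0 : ∀ x : Lˣ, ((v x : ℝ≥0) : ℝ) ≠ 0 := fun x => by simp
    rw [ofAdd_add, map_mul, Units.val_mul, map_mul, NNReal.coe_mul,
      Real.log_mul (h0 _) (h0 _), map_add]
    ring)
  have hD : ∀ i, |D (b i)| ≤ ε := fun i => by
    change |-Real.log (v (y (.ofAdd (b i)))) - w (b i)| ≤ ε
    rw [hy]
    exact hz i
  refine ⟨y, fun u => ?_⟩
  change |D u| ≤ _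
  have hu : D u = ∑ i, (b.repr u i : ℝ) * D (b i) := by
    rw [← congrArg D (b.sum_repr u), map_sum]
    exact Finset.sum_congr rfl fun i _ => by rw [map_zsmul, zsmul_eq_mul]
  rw [hu, Finset.sum_mul]
  refine (Finset.abs_sum_le_sum_abs _ _).trans (Finset.sum_le_sum fun i _ => ?_)
  rw [abs_mul]
  exact mul_le_mul_of_nonneg_left (hD i) (abs_nonneg _)

/-- Kapranov's theorem: if the tropicalization of a Laurent polynomial attains its minimum at `w`
twice, then `w` is a limit of tropicalizations of zeros. The zeros are found on translates of
the image of a one-parameter subgroup. -/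
theorem exists_zero_neg_log_approx [IsAlgClosed L]
    (hv : ∀ (a ε : ℝ), 0 < ε → ∃ z : Lˣ, |-Real.log (v z) - a| ≤ ε) (w : M →+ ℝ)
    (S : Finset M) (a : M → L) (ha : ∀ u ∈ S, a u ≠ 0) {u₁ u₂ : M} (hu₁ : u₁ ∈ S) (hu₂ : u₂ ∈ S)
    (hne : u₁ ≠ u₂) (h₁ : ∀ u ∈ S, -Real.log (v (a u₁)) + w u₁ ≤ -Real.log (v (a u)) + w u)
    (h₂ : ∀ u ∈ S, -Real.log (v (a u₂)) + w u₂ ≤ -Real.log (v (a u)) + w u) :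
    ∃ C : M → ℝ, ∀ ε : ℝ, 0 < ε → ∃ x : Multiplicative M →* Lˣ,
      ∑ u ∈ S, a u * (x (.ofAdd u) : L) = 0 ∧
      ∀ u, |-Real.log (v (x (.ofAdd u))) - w u| ≤ C u * ε := by
  obtain ⟨e, he⟩ := exists_addMonoidHom_int_injOn S
  obtain ⟨C, hC⟩ := exists_monoidHom_neg_log_approx v hv w
  obtain ⟨u₃, hu₃, hC₃⟩ := S.exists_max_image C ⟨u₁, hu₁⟩
  have hC0 : ∀ u, 0 ≤ C u := fun u => by
    obtain ⟨y, hy⟩ := hC 1 one_pos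
    simpa using (abs_nonneg _).trans (hy u)
  refine ⟨fun u => C u + |(e u : ℝ)| * (2 * C u₃), fun ε hε => ?_⟩
  obtain ⟨y, hy⟩ := hC ε hε
  have hpos : ∀ x : Lˣ, 0 < ((v x : ℝ≥0) : ℝ) := fun x => by simp [pos_iff_ne_zero]
  have hc0 : ∀ u ∈ S, 0 < ((v (a u * y (.ofAdd u)) : ℝ≥0) : ℝ) := fun u hu => by
    simp [pos_iff_ne_zero, ha u hu]
  have hlog : ∀ u ∈ S, Real.log (v (a u * y (.ofAdd u))) =
      Real.log (v (a u)) + Real.log (v (y (.ofAdd u))) := fun u hu => by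
    rw [map_mul, NNReal.coe_mul, Real.log_mul _ (hpos _).ne']
    simpa using ha u hu
  obtain ⟨m, hmS, hm⟩ := S.exists_max_image (fun u => v (a u * y (.ofAdd u))) ⟨u₁, hu₁⟩
  have hmin : ∃ n ∈ S, m ≠ n ∧ -Real.log (v (a n)) + w n ≤ -Real.log (v (a m)) + w m := by
    by_cases hm1 : m = u₁
    · exact ⟨u₂, hu₂, hm1 ▸ hne, h₂ m hmS⟩
    · exact ⟨u₁, hu₁, hm1, h₁ m hmS⟩
  obtain ⟨n, hnS, hmn, hle⟩ := hmin
  set T : ℝ := 2 * C u₃ * ε with hT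
  have hT0 : 0 ≤ T := by have := hC0 u₃; positivity
  have hexp : ((Real.exp T).toNNReal : ℝ) = Real.exp T := Real.coe_toNNReal _ (Real.exp_pos T).le
  obtain ⟨r, hr, hr1, hr2⟩ := exists_unit_sum_zpow_eq_zero v S (fun u => a u * y (.ofAdd u)) e he
    hmS hnS hmn (mul_ne_zero (ha m hmS) (Units.ne_zero _)) hm (t := (Real.exp T).toNNReal)
    (by rw [← NNReal.coe_le_coe, hexp]; simpa using hT0)
    (by
      rw [← NNReal.coe_le_coe, NNReal.coe_mul, hexp, ← Real.exp_log (hc0 m hmS),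
        ← Real.exp_log (hc0 n hnS), ← Real.exp_add, Real.exp_le_exp, hlog m hmS, hlog n hnS]
      have e1 := abs_le.1 (hy m)
      have e2 := abs_le.1 (hy n)
      have e3 := mul_le_mul_of_nonneg_right (hC₃ m hmS) hε.le
      have e4 := mul_le_mul_of_nonneg_right (hC₃ n hnS) hε.le
      linarith [e1.1, e1.2, e2.1, e2.2])
  have hrT : |Real.log (v r)| ≤ T := by
    rw [← NNReal.coe_le_coe, hexp] at hr2
    rw [← NNReal.coe_le_coe, NNReal.coe_inv, hexp, ← Real.exp_neg] at hr1
    exact abs_le.2 ⟨(Real.le_log_iff_exp_le (hpos r)).2 hr1, (Real.log_le_iff_le_exp (hpos r)).2 hr2⟩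
  refine ⟨y * (zpowersHom Lˣ r).comp (AddMonoidHom.toMultiplicative e), ?_, fun u => ?_⟩
  · rw [← hr]
    refine Finset.sum_congr rfl fun u _ => ?_
    simp [mul_assoc]
  · have hx : Real.log (v ((y * (zpowersHom Lˣ r).comp (AddMonoidHom.toMultiplicative e))
        (.ofAdd u) : Lˣ)) = Real.log (v (y (.ofAdd u))) + e u * Real.log (v r) := by
      rw [MonoidHom.mul_apply, Units.val_mul, map_mul, NNReal.coe_mul,
        Real.log_mul (hpos _).ne' (hpos _).ne']
      simp [Real.log_zpow]
    rw [hx]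
    calc |-(Real.log (v (y (.ofAdd u))) + e u * Real.log (v r)) - w u|
        = |(-Real.log (v (y (.ofAdd u))) - w u) + -(e u * Real.log (v r))| := by ring_nf
      _ ≤ C u * ε + |(e u : ℝ)| * T := by
        refine (abs_add_le _ _).trans (add_le_add (hy u) ?_)
        rw [abs_neg, abs_mul]
        exact mul_le_mul_of_nonneg_left hrT (abs_nonneg _)
      _ = _ := by rw [hT]; ring

end Lattice


/-! ### Amoebas and tropicalizations -/

section Amoeba

variable {k K : Type*} [Field k] [Field K] [Algebra k K]

namespace Place

variable (p : Place k K) {c : ℝ≥0} (hc : 1 < c)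

/-- The extended absolute value on the algebraic closure of `K_p`, as a valuation. -/
noncomputable def algValuation : Valuation (p.AlgClosure hc) ℝ≥0 where
  toFun x := Real.toNNReal (p.algAbs hc x)
  map_zero' := by simp
  map_one' := by simp
  map_mul' x y := by rw [map_mul, Real.toNNReal_mul (apply_nonneg _ x)]
  map_add_le_max' x y := by
    have hmono : Monotone Real.toNNReal := fun _ _ h => Real.toNNReal_mono h
    rw [← hmono.map_max]
    exact Real.toNNReal_mono (isNonarchimedean_spectralNorm x y)

theorem coe_algValuation (x : p.AlgClosure hc) : (p.algValuation hc x : ℝ) = p.algAbs hc x :=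
  Real.coe_toNNReal _ (apply_nonneg _ x)

theorem algValuation_toAlgClosure (a : K) :
    (p.algValuation hc (p.toAlgClosure hc a) : ℝ) = p.absVal hc a :=
  (p.coe_algValuation hc _).trans <| (spectralNorm_extends _).trans (p.norm_toCompletion hc a)

theorem absVal_le_iff {a b : K} : p.absVal hc a ≤ p.absVal hc b ↔ p.valuation a ≤ p.valuation b := by
  rw [← (WithZeroMulInt.toNNReal_strictMono hc).le_iff_le]
  exact NNReal.coe_le_coe

theorem absVal_eq_one_of_valuation_eq_one {a : K} (ha : p.valuation a = 1) : p.absVal hc a = 1 := by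
  change ((WithZeroMulInt.toNNReal (ne_zero_of_lt hc) (p.valuation a) : ℝ≥0) : ℝ) = 1
  simp [ha]

/-- The value group of the algebraic closure of `K_p` is divisible, hence dense. -/
theorem exists_neg_log_algValuation_approx (a ε : ℝ) (hε : 0 < ε) :
    ∃ z : (p.AlgClosure hc)ˣ, |-Real.log (p.algValuation hc z) - a| ≤ ε := by
  obtain ⟨b, hb⟩ := p.exists_one_lt_absVal hc
  set l := Real.log (p.absVal hc b) with hl
  have hl0 : 0 < l := Real.log_pos hb
  obtain ⟨n, hn⟩ := exists_nat_gt (l / ε)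
  have hn0 : (0 : ℝ) < n := (div_pos hl0 hε).trans hn
  obtain ⟨z, hz⟩ := IsAlgClosed.exists_pow_nat_eq (p.toAlgClosure hc b) (Nat.cast_pos.1 hn0)
  have hb0 : b ≠ 0 := by rintro rfl; simp at hb; linarith
  have hz0 : z ≠ 0 := by
    rintro rfl
    rw [zero_pow (Nat.cast_pos.1 hn0).ne'] at hz
    exact hb0 ((map_eq_zero _).1 hz.symm)
  have hlog : Real.log (p.algValuation hc z) = l / n := by
    rw [eq_div_iff hn0.ne', mul_comm, ← Real.log_pow, hl, ← algValuation_toAlgClosure, ← hz, map_pow,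
      NNReal.coe_pow]
  have hd0 : 0 < l / n := div_pos hl0 hn0
  have hd : l / n ≤ ε := by
    rw [div_le_iff₀ hn0]
    rw [div_lt_iff₀ hε] at hn
    linarith
  refine ⟨Units.mk0 z hz0 ^ (-⌊a / (l / n)⌋), ?_⟩
  rw [Units.val_zpow_eq_zpow_val, Units.val_mk0, map_zpow₀, NNReal.coe_zpow, Real.log_zpow, hlog]
  have h1 := Int.floor_le (a / (l / n))
  have h2 := Int.lt_floor_add_one (a / (l / n))
  rw [le_div_iff₀ hd0] at h1
  rw [div_lt_iff₀ hd0] at h2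
  push_cast
  rw [abs_le]
  constructor <;> nlinarith

end Place

variable {M : Type*} [AddCommGroup M]

theorem continuous_eval_character (u : M) : Continuous fun w : M →+ ℝ => w u :=
  (continuous_apply u).comp continuous_induced_dom

/-- A weak form of the easy half of Kapranov's theorem: on the amoeba, two terms of each equation have the same
tropicalization. -/
theorem exists_ne_of_mem_amoeba {I : Ideal (AddMonoidAlgebra K M)} {p : Place k K} {c : ℝ≥0}
    (hc : 1 < c) {g : AddMonoidAlgebra K M} (hg : g ∈ I) (hg0 : g ≠ 0) {w : M →+ ℝ}
    (hw : w ∈ amoeba I p hc) :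
    ∃ u ∈ g.coeff.support, ∃ u' ∈ g.coeff.support, u ≠ u' ∧
      -Real.log (p.absVal hc (g.coeff u)) + w u = -Real.log (p.absVal hc (g.coeff u')) + w u' := by
  classical
  set S := g.coeff.support
  let Z : Set (M →+ ℝ) := ⋃ q ∈ S.offDiag,
    {w | -Real.log (p.absVal hc (g.coeff q.1)) + w q.1 =
      -Real.log (p.absVal hc (g.coeff q.2)) + w q.2}
  have hZ : IsClosed Z := Set.Finite.isClosed_biUnion (Finset.finite_toSet _) fun q _ =>
    isClosed_eq (continuous_const.add (continuous_eval_character q.1))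
      (continuous_const.add (continuous_eval_character q.2))
  have hsub : amoeba I p hc ⊆ Z := by
    refine closure_minimal ?_ hZ
    rintro _ ⟨x, hx, rfl⟩
    obtain ⟨u₀, hu₀⟩ : S.Nonempty := by
      rw [Finsupp.support_nonempty_iff]
      simpa using hg0
    have hne : ∀ u ∈ S, p.algValuation hc (p.toAlgClosure hc (g.coeff u)) ≠ 0 := fun u hu => by
      simpa using Finsupp.mem_support_iff.1 hu
    have hx0 : ∀ u, p.algValuation hc (x (.ofAdd u) : p.AlgClosure hc) ≠ 0 := fun u => by simp
    obtain ⟨u, hu, u', hu', huu, heq, -⟩ := exists_ne_valuation_eq_of_sum_eq_zero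
      (p.algValuation hc) S (fun u => p.toAlgClosure hc (g.coeff u) * (x (.ofAdd u) : p.AlgClosure hc))
      ⟨u₀, hu₀, by rw [map_mul]; exact mul_ne_zero (hne _ hu₀) (hx0 _)⟩ (hx g hg)
    refine Set.mem_iUnion₂.2 ⟨(u, u'), Finset.mem_offDiag.2 ⟨hu, hu', huu⟩, ?_⟩
    have hlog := congrArg (fun r : ℝ≥0 => -Real.log r) heq
    simp only [map_mul, NNReal.coe_mul] at hlog
    rw [Real.log_mul (by exact_mod_cast hne u hu) (by exact_mod_cast hx0 u),
      Real.log_mul (by exact_mod_cast hne u' hu') (by exact_mod_cast hx0 u'),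
      p.algValuation_toAlgClosure, p.algValuation_toAlgClosure, neg_add, neg_add,
      p.coe_algValuation, p.coe_algValuation] at hlog
    exact hlog
  obtain ⟨q, hq, hqw⟩ := Set.mem_iUnion₂.1 (hsub hw)
  obtain ⟨h1, h2, h3⟩ := Finset.mem_offDiag.1 hq
  exact ⟨q.1, h1, q.2, h2, h3, hqw⟩

/-- A zero of a generator of the ideal is a point of the subscheme. -/
theorem mem_points_span_singleton {L : Type*} [Field L] (φ : K →+* L) (f : AddMonoidAlgebra K M)
    (x : Multiplicative M →* Lˣ)
    (hx : f.coeff.sum (fun u a => φ a * (x (Multiplicative.ofAdd u) : L)) = 0) :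
    x ∈ points (Ideal.span {f}) φ := by
  let E : AddMonoidAlgebra K M →+* L := AddMonoidAlgebra.liftNCRingHom φ ((Units.coeHom L).comp x)
    fun _ _ => Commute.all _ _
  have hE : ∀ g, E g = g.coeff.sum (fun u a => φ a * (x (Multiplicative.ofAdd u) : L)) :=
    fun g => rfl
  intro g hg
  obtain ⟨h, rfl⟩ := Ideal.mem_span_singleton'.1 hg
  rw [← hE, map_mul, hE f, hx, mul_zero]

/-- The hard half of Kapranov's theorem, over the algebraic closure of `K_p`. -/
theorem mem_amoeba_of_min_attained_twice [Module.Free ℤ M] [Module.Finite ℤ M] {p : Place k K}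
    {c : ℝ≥0} (hc : 1 < c) (f : AddMonoidAlgebra K M) (w : M →+ ℝ) {u₁ u₂ : M}
    (hu₁ : u₁ ∈ f.coeff.support) (hu₂ : u₂ ∈ f.coeff.support) (hne : u₁ ≠ u₂)
    (h₁ : ∀ u ∈ f.coeff.support, -Real.log (p.absVal hc (f.coeff u₁)) + w u₁ ≤
      -Real.log (p.absVal hc (f.coeff u)) + w u)
    (h₂ : ∀ u ∈ f.coeff.support, -Real.log (p.absVal hc (f.coeff u₂)) + w u₂ ≤
      -Real.log (p.absVal hc (f.coeff u)) + w u) :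
    w ∈ amoeba (Ideal.span {f}) p hc := by
  obtain ⟨C, hC⟩ := exists_zero_neg_log_approx (p.algValuation hc)
    (p.exists_neg_log_algValuation_approx hc) w f.coeff.support
    (fun u => p.toAlgClosure hc (f.coeff u))
    (fun u hu => by simpa using Finsupp.mem_support_iff.1 hu) hu₁ hu₂ hne
    (by simpa only [p.algValuation_toAlgClosure] using h₁)
    (by simpa only [p.algValuation_toAlgClosure] using h₂)
  simp only [p.coe_algValuation] at hC
  choose x hx hxw using fun n : ℕ => hC (1 / ((n : ℝ) + 1)) Nat.one_div_pos_of_nat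
  refine mem_closure_of_tendsto (b := Filter.atTop) (f := fun n => negLogAbs p hc (x n)) ?_
    (Filter.Eventually.of_forall fun n =>
      ⟨x n, mem_points_span_singleton _ f _ (hx n), rfl⟩)
  rw [nhds_induced, Filter.tendsto_comap_iff, tendsto_pi_nhds]
  intro u
  rw [tendsto_iff_norm_sub_tendsto_zero]
  refine squeeze_zero (fun _ => norm_nonneg _) (fun n => hxw n u) ?_
  simpa using (tendsto_one_div_add_atTop_nhds_zero_nat (𝕜 := ℝ)).const_mul (C u)

/-! ### Half lines -/

/-- If among finitely many affine functions of `t > 0` the minimum is never attained twice, then one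
of them is the minimum throughout, because `(0, ∞)` is connected. -/
theorem exists_forall_affine_lt {ι : Type*} (S : Finset ι) (hS : S.Nonempty) (α β : ι → ℝ)
    (h : ∀ t : ℝ, 0 < t → ∀ i ∈ S, ∀ j ∈ S, (∀ l ∈ S, α i + t * β i ≤ α l + t * β l) →
      (∀ l ∈ S, α j + t * β j ≤ α l + t * β l) → i = j) :
    ∃ i ∈ S, ∀ j ∈ S, j ≠ i → ∀ t : ℝ, 0 < t → α i + t * β i < α j + t * β j := by
  classical
  let U : ι → Set ℝ := fun i => ⋂ j ∈ S.erase i, {t | α i + t * β i < α j + t * β j}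
  have hUo : ∀ i, IsOpen (U i) := fun i => isOpen_biInter_finset fun j _ =>
    isOpen_lt (by fun_prop) (by fun_prop)
  have hU : ∀ i t, t ∈ U i ↔ ∀ j ∈ S, j ≠ i → α i + t * β i < α j + t * β j := by
    intro i t
    simp only [U, Set.mem_iInter, Finset.mem_erase, Set.mem_ofPred_eq]
    exact ⟨fun h j hj hji => h j ⟨hji, hj⟩, fun h j hj => h j hj.2 hj.1⟩
  have hcover : ∀ t : ℝ, 0 < t → ∃ i ∈ S, t ∈ U i := by
    intro t ht
    obtain ⟨i, hi, him⟩ := S.exists_min_image (fun i => α i + t * β i) hS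
    refine ⟨i, hi, (hU i t).2 fun j hj hji => lt_of_le_of_ne (him j hj) fun heq => hji ?_⟩
    exact h t ht j hj i hi (fun l hl => heq ▸ him l hl) him
  obtain ⟨i, hi, hi1⟩ := hcover 1 one_pos
  refine ⟨i, hi, ?_⟩
  suffices hall : ∀ t : ℝ, 0 < t → t ∈ U i from
    fun j hj hji t ht => (hU i t).1 (hall t ht) j hj hji
  intro t ht
  by_contra hti
  have hV : ∀ s, (s ∈ ⋃ j ∈ S.erase i, U j) ↔ ∃ j ∈ S, j ≠ i ∧ s ∈ U j := by
    intro s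
    simp only [Set.mem_iUnion, Finset.mem_erase, exists_prop]
    exact ⟨fun ⟨j, ⟨a, b⟩, c⟩ => ⟨j, b, a, c⟩, fun ⟨j, b, a, c⟩ => ⟨j, ⟨a, b⟩, c⟩⟩
  obtain ⟨s, -, hsi, hsj⟩ := (isPreconnected_Ioi (a := (0 : ℝ))) (U i) (⋃ j ∈ S.erase i, U j)
    (hUo i) (isOpen_biUnion fun j _ => hUo j)
    (fun s hs => by
      obtain ⟨j, hj, hsj⟩ := hcover s hs
      by_cases hji : j = i
      · exact Or.inl (hji ▸ hsj)
      · exact Or.inr ((hV s).2 ⟨j, hj, hji, hsj⟩))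
    ⟨1, Set.mem_Ioi.2 one_pos, hi1⟩
    (by
      obtain ⟨j, hj, htj⟩ := hcover t ht
      exact ⟨t, ht, (hV t).2 ⟨j, hj, fun hji => hti (hji ▸ htj), htj⟩⟩)
  obtain ⟨j, hj, hji, hsj⟩ := (hV s).1 hsj
  exact lt_asymm ((hU i s).1 hsi j hj hji) ((hU j s).1 hsj i hi hji.symm)

theorem le_and_le_of_forall_affine_lt {a b a' b' : ℝ}
    (h : ∀ t : ℝ, 0 < t → a + t * b < a' + t * b') : a ≤ a' ∧ b ≤ b' := by
  constructor
  · by_contra! hlt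
    have hd : 0 < |b' - b| + 1 := by positivity
    have h1 := h ((a - a') / (|b' - b| + 1)) (div_pos (sub_pos.2 hlt) hd)
    have h2 : (a - a') / (|b' - b| + 1) * (b' - b) ≤ a - a' := by
      rw [div_mul_eq_mul_div, div_le_iff₀ hd]
      exact mul_le_mul_of_nonneg_left ((le_abs_self _).trans (by linarith)) (sub_pos.2 hlt).le
    linarith
  · by_contra! hlt
    have hd : 0 < b - b' := sub_pos.2 hlt
    have h1 := h ((|a' - a| + 1) / (b - b')) (div_pos (by positivity) hd)
    have h2 : (|a' - a| + 1) / (b - b') * (b - b') = |a' - a| + 1 := div_mul_cancel₀ _ hd.ne'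
    have h3 := le_abs_self (a' - a)
    linarith

/-- If an open half line misses the amoeba at `p`, then one coefficient dominates along all of
it. -/
theorem exists_forall_lt_of_disjoint_amoeba [Module.Free ℤ M] [Module.Finite ℤ M] {p : Place k K}
    {c : ℝ≥0} (hc : 1 < c) (f : AddMonoidAlgebra K M) (hf : f.coeff.support.Nonempty) (v : M →+ ℝ)
    (h : Disjoint (openHalfLine v) (amoeba (Ideal.span {f}) p hc)) :
    ∃ u₀ ∈ f.coeff.support, ∀ u ∈ f.coeff.support, u ≠ u₀ → ∀ t : ℝ, 0 < t →
      -Real.log (p.absVal hc (f.coeff u₀)) + t * v u₀ <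
        -Real.log (p.absVal hc (f.coeff u)) + t * v u := by
  refine exists_forall_affine_lt _ hf _ _ fun t ht u₁ hu₁ u₂ hu₂ h₁ h₂ => ?_
  by_contra hne
  exact Set.disjoint_left.1 h ⟨t, ht, rfl⟩
    (mem_amoeba_of_min_attained_twice hc f (t • v) hu₁ hu₂ hne h₁ h₂)

/-- A Laurent polynomial whose coefficients are in `k` up to a common factor has a zero locus
defined over `k`. -/
theorem isDefinedOver_span_singleton {f : AddMonoidAlgebra K M} {a : K} (ha : a ≠ 0)
    (h : ∀ u, f.coeff u / a ∈ (algebraMap k K).range) : IsDefinedOver k (Ideal.span {f}) := by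
  have hmem : AddMonoidAlgebra.single 0 a⁻¹ * f ∈
      Set.range (AddMonoidAlgebra.map (M := M) (algebraMap k K : k →+ K)) := by
    rw [AddMonoidAlgebra.range_map]
    intro u
    rw [AddMonoidAlgebra.coeff_single_zero_mul]
    simpa [div_eq_inv_mul] using h u
  obtain ⟨g, hg⟩ := hmem
  refine ⟨Ideal.span {g}, ?_⟩
  have hg' : AddMonoidAlgebra.mapRingHom M (algebraMap k K) g =
      AddMonoidAlgebra.single 0 a⁻¹ * f := hg
  have hu : IsUnit (AddMonoidAlgebra.single 0 a⁻¹ : AddMonoidAlgebra K M) := by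
    refine IsUnit.of_mul_eq_one (AddMonoidAlgebra.single 0 a) ?_
    rw [AddMonoidAlgebra.single_mul_single, inv_mul_cancel₀ ha, add_zero]
    rfl
  rw [Ideal.map_span, Set.image_singleton, hg', Ideal.span_singleton_mul_left_unit hu]

variable [Module.Free ℤ M] [Module.Finite ℤ M]

/-- If an open half line misses all amoebas, then one coefficient dominates all others at every
place, so that the quotients by it have no poles and are constants. -/
theorem isDefinedOver_of_disjoint (hK : IsCurveFunctionField k K) (c : Place k K → ℝ≥0)
    (hc : ∀ p, 1 < c p) (f : AddMonoidAlgebra K M) (hf : f.coeff.support.Nonempty) (v : M →+ ℝ)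
    (h : Disjoint (openHalfLine v) (adelicAmoeba (Ideal.span {f}) c hc)) :
    IsDefinedOver k (Ideal.span {f}) := by
  classical
  choose m hmS hm using fun p => exists_forall_lt_of_disjoint_amoeba (hc p) f hf v
    (h.mono_right (Set.subset_iUnion (fun p => amoeba (Ideal.span {f}) p (hc p)) p))
  -- at a place where all coefficients are units, the dominating exponent is the unique minimum of `v`
  obtain ⟨q, hq⟩ := hK.exists_valuation_eq_one (f.coeff.support.image f.coeff) (by
    intro b hb
    obtain ⟨u, hu, rfl⟩ := Finset.mem_image.1 hb
    exact Finsupp.mem_support_iff.1 hu)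
  have hq1 : ∀ u ∈ f.coeff.support, q.absVal (hc q) (f.coeff u) = 1 := fun u hu =>
    q.absVal_eq_one_of_valuation_eq_one (hc q) (hq _ (Finset.mem_image_of_mem _ hu))
  have hmin : ∀ u ∈ f.coeff.support, u ≠ m q → v (m q) < v u := by
    intro u hu hne
    have := hm q u hu hne 1 one_pos
    rw [hq1 u hu, hq1 _ (hmS q)] at this
    simpa using this
  have hmq : ∀ p, m p = m q := by
    intro p
    by_contra hne
    exact (hmin _ (hmS p) hne).not_ge
      (le_and_le_of_forall_affine_lt (hm p (m q) (hmS q) (Ne.symm hne))).2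
  have ha : f.coeff (m q) ≠ 0 := Finsupp.mem_support_iff.1 (hmS q)
  refine isDefinedOver_span_singleton ha fun u => ?_
  by_cases hu : f.coeff u = 0
  · exact ⟨0, by simp [hu]⟩
  refine hK.mem_range_of_isAlgebraic _ ?_
  by_contra htr
  obtain ⟨p, hp⟩ := hK.exists_one_lt_valuation htr
  refine hp.not_ge ?_
  rw [map_div₀]
  refine div_le_one_of_le₀ ?_ zero_le
  by_cases hne : u = m q
  · rw [hne]
  have hlog := (le_and_le_of_forall_affine_lt
    (hm p u (Finsupp.mem_support_iff.2 hu) (by rwa [hmq]))).1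
  rw [hmq, neg_le_neg_iff, Real.log_le_log_iff ((p.absVal (hc p)).pos hu)
    ((p.absVal (hc p)).pos ha), p.absVal_le_iff] at hlog
  exact hlog

/-- A cocharacter that separates the exponents of an equation over `k` spans a half line that misses
all amoebas. -/
theorem exists_disjoint_of_isDefinedOver (c : Place k K → ℝ≥0) (hc : ∀ p, 1 < c p)
    {I : Ideal (AddMonoidAlgebra K M)} (hI : I ≠ ⊥) [Nontrivial M] (h : IsDefinedOver k I) :
    ∃ v : M →+ ℝ, v ≠ 0 ∧ Disjoint (openHalfLine v) (adelicAmoeba I c hc) := by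
  classical
  obtain ⟨J, rfl⟩ := h
  obtain ⟨g, hgJ, hg0⟩ := Submodule.exists_mem_ne_zero_of_ne_bot
    (show J ≠ ⊥ by rintro rfl; exact hI Ideal.map_bot)
  obtain ⟨u₀, hu₀⟩ := exists_ne (0 : M)
  -- including `0` and `u₀` makes the cocharacter nonzero
  obtain ⟨e, he⟩ := exists_addMonoidHom_int_injOn (g.coeff.support ∪ {0, u₀})
  let v : M →+ ℝ := (Int.castAddHom ℝ).comp e
  have hv : Set.InjOn v (g.coeff.support ∪ {0, u₀} : Finset M) := fun a ha b hb hab =>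
    he ha hb (Int.cast_injective (α := ℝ) hab)
  refine ⟨v, fun h0 => hu₀ (hv (by simp) (by simp) (by simp [h0])), ?_⟩
  rw [Set.disjoint_left]
  rintro _ ⟨t, ht, rfl⟩ hmem
  obtain ⟨p, hp⟩ := Set.mem_iUnion.1 hmem
  set G := AddMonoidAlgebra.mapRingHom M (algebraMap k K) g
  have hG : ∀ u, G.coeff u = algebraMap k K (g.coeff u) := fun u => rfl
  have hG0 : G ≠ 0 := fun h => hg0 (by
    ext u
    have := hG u
    rw [h] at this
    simpa using this.symm)
  obtain ⟨u, hu, u', hu', hne, heq⟩ := exists_ne_of_mem_amoeba (hc p)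
    (Ideal.mem_map_of_mem (AddMonoidAlgebra.mapRingHom M (algebraMap k K)) hgJ) hG0 hp
  have hmem : ∀ u ∈ G.coeff.support, u ∈ g.coeff.support := fun u hu => by
    rw [Finsupp.mem_support_iff, hG] at hu
    exact Finsupp.mem_support_iff.2 fun h => hu (by rw [h, map_zero])
  have hone : ∀ u ∈ G.coeff.support, p.absVal (hc p) (G.coeff u) = 1 := fun u hu =>
    p.absVal_eq_one_of_valuation_eq_one (hc p)
      (by rw [hG]; exact p.trivial_on _ (Finsupp.mem_support_iff.1 (hmem u hu)))
  rw [hone u hu, hone u' hu', add_right_inj] at heq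
  refine hne (hv (by simp [hmem u hu]) (by simp [hmem u' hu']) ?_)
  exact mul_left_cancel₀ ht.ne' heq

end Amoeba

end AdelicAmoeba

theorem proposition3p2 {k K : Type*} [Field k] [Field K] [Algebra k K]
    (hK : AdelicAmoeba.IsCurveFunctionField k K)
    {M : Type*} [AddCommGroup M] [Module.Free ℤ M] [Module.Finite ℤ M]
    (c : AdelicAmoeba.Place k K → NNReal) (hc : ∀ p, 1 < c p)
    (I : Ideal (AddMonoidAlgebra K M)) (hI : AdelicAmoeba.IsHypersurface I) :
    (∃ v : M →+ ℝ, v ≠ 0 ∧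
        Disjoint (AdelicAmoeba.openHalfLine v) (AdelicAmoeba.adelicAmoeba I c hc)) ↔
      AdelicAmoeba.IsDefinedOver k I := by
  obtain ⟨f, hf, rfl⟩ := hI
  constructor
  · rintro ⟨v, -, hv⟩
    exact AdelicAmoeba.isDefinedOver_of_disjoint hK c hc f (Finset.card_pos.1 (by omega)) v hv
  · obtain ⟨u, -, u', -, hne⟩ := Finset.one_lt_card.1 hf
    have : Nontrivial M := ⟨u, u', hne⟩
    refine AdelicAmoeba.exists_disjoint_of_isDefinedOver c hc fun h0 => ?_
    rw [Ideal.span_singleton_eq_bot] at h0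
    simp [h0] at hf
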